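/- **Proposition 6.2 (Example 6.2).** Let $0<\lambda<\min\{\mu_1,\mu_2\}$ and $\mu_1<\mu_2$, and put $\rho_2=\lambda/\mu_2$. Let $\eta\in(0,1)$ be the zero in $(0,1)$ of $$\tau(x)=-\lambda-\mu_1-\mu_2(1-x)+2\sqrt{\lambda\mu_1/x},$$ and let $z\in[\eta,\rho_2]$. Define $(w_k)_{k\ge0}$ by $w_0=1$, $\mu_1w_1=(\lambda+\mu_2(1-z))\,z\,w_0$ and $$\mu_1w_{k+1}=(\lambda+\mu_1+\mu_2(1-z))\,z\,w_k-\lambda z\,w_{k-1},\qquad k\ge1,$$ and $(\nu_i)_{i\ge1}$ by $$\nu_1=\frac{(\lambda-\mu_2z)w_0}{w_1},\qquad \nu_{i+1}=\frac{(\nu_i+\lambda+\mu_1-\mu_2z)w_i-\lambda w_{i-1}}{w_{i+1}},\qquad i\ge1 .$$ Consider the continuous-time Markov chain on $\{0,1,2,\dots\}^2$ (a state $(k,i)$ means $k$ customers in the second queue and $i$ in the first) with transition rates $\lambda$ from $(k,i)$ to $(k,i+1)$; $\mu_1$ from $(k,i)$ to $(k+1,i-1)$ for $i\ge1$; $\mu_2$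 from $(k,i)$ to $(k-1,i)$ for $k\ge1$; and $\nu_i$ from $(0,i)$ to $(0,i-1)$ for $i\ge1$. Then: 1. $w_k>0$ for all $k\ge 0$, and $\sum_kw_k<\infty$. 2. If $z<\rho_2$, then $\nu_i>0$ for all $i\ge1$. If $z=\rho_2$, then $\nu_i=0$ for all $i\ge1$ (so the network is the unmodified tandem network). 3. There is an honest standard transition function $P_t$, $t\ge0$, with these transition rates. There is a probability distribution $\pi$ on the state space which, for every such $P_t$, is the unique stationary distribution and satisfies $\lim_{t\to\infty}P_t(x,y)=\pi(y)$ for all states $x,y$. 4. $\pi$ decays geometrically at rate exactly $z$ in the level: there is $c>0$ with $\pi(K,i)=c\,z^K w_i$ for all $K,i\ge0$. In particular, for each $i$, $\pi(K,i)/z^K$ converges to a strictly positive limit as $K\to\infty$, and so does $\sum_i\pi(K,i)/z^K$. -/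

import Mathlib

open Filter Topology

noncomputable section

/-! Continuous-time Markov chains on a countable state space, through their transition functions. -/

/-- `P` is an honest standard transition function on `S` with generator (`q`-matrix) `Q`:
`P t x y` is the probability that the chain is in state `y` at time `t ≥ 0` when it starts in `x`.
Only the values at times `t ≥ 0` matter. -/
structure IsTransitionFunction {S : Type*} [DecidableEq S] (Q : S → S → ℝ)
    (P : ℝ → S → S → ℝ) : Prop where
  nonneg : ∀ t, 0 ≤ t → ∀ x y, 0 ≤ P t x y
  honest : ∀ t, 0 ≤ t → ∀ x, HasSum (fun y => P t x y) 1
  initial : ∀ x y, P 0 x y = if x = y then 1 else 0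
  chapman_kolmogorov : ∀ s t, 0 ≤ s → 0 ≤ t → ∀ x y,
    HasSum (fun u => P s x u * P t u y) (P (s + t) x y)
  generator : ∀ x y, HasDerivWithinAt (fun t => P t x y) (Q x y) (Set.Ici 0) 0

/-- `p` is a stationary (invariant) probability distribution of the transition function `P`. -/
structure IsStationaryDistribution {S : Type*} (P : ℝ → S → S → ℝ) (p : S → ℝ) : Prop where
  nonneg : ∀ x, 0 ≤ p x
  total : HasSum p 1
  invariant : ∀ t, 0 ≤ t → ∀ y, HasSum (fun x => p x * P t x y) (p y)

/-- The sequence `a` decays geometrically with rate exactly `z`: `a K / z ^ K` tends to a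
strictly positive constant. -/
def HasGeometricDecayRate (a : ℕ → ℝ) (z : ℝ) : Prop :=
  ∃ κ : ℝ, 0 < κ ∧ Tendsto (fun K => a K / z ^ K) atTop (𝓝 κ)

/-! The tandem Jackson network. A state is a pair `(level, phase)`: the level is the number of
customers in the second queue, the phase the number of customers in the first queue. -/

/-- The function `τ(z) = -λ - μ₁ - μ₂ (1 - z) + 2 √(λ μ₁ / z)`. -/
def tandemTau (lam μ₁ μ₂ z : ℝ) : ℝ :=
  -lam - μ₁ - μ₂ * (1 - z) + 2 * √(lam * μ₁ / z)

/-- The vector `w`, normalised by `w₀ = 1`, determined by the equations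
`-(λ + μ₂ (1 - z)) z w₀ + μ₁ w₁ = 0` and
`λ z wₖ₋₁ - (λ + μ₁ + μ₂ (1 - z)) z wₖ + μ₁ wₖ₊₁ = 0` for `k ≥ 1`. -/
def tandemW (lam μ₁ μ₂ z : ℝ) : ℕ → ℝ
  | 0 => 1
  | 1 => (lam + μ₂ * (1 - z)) * z / μ₁
  | k + 2 =>
      ((lam + μ₁ + μ₂ * (1 - z)) * z * tandemW lam μ₁ μ₂ z (k + 1)
        - lam * z * tandemW lam μ₁ μ₂ z k) / μ₁

/-- The removal rates: `ν₁ = (λ - μ₂ z) w₀ / w₁` and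
`νᵢ₊₁ = ((νᵢ + λ + μ₁ - μ₂ z) wᵢ - λ wᵢ₋₁) / wᵢ₊₁` for `i ≥ 1`.
There is no removal rate with index `0`; the value there is a dummy that is never used. -/
def removalRate (lam μ₁ μ₂ z : ℝ) : ℕ → ℝ
  | 0 => 0
  | 1 => (lam - μ₂ * z) * tandemW lam μ₁ μ₂ z 0 / tandemW lam μ₁ μ₂ z 1
  | i + 2 =>
      ((removalRate lam μ₁ μ₂ z (i + 1) + lam + μ₁ - μ₂ * z) * tandemW lam μ₁ μ₂ z (i + 1)
        - lam * tandemW lam μ₁ μ₂ z i) / tandemW lam μ₁ μ₂ z (i + 2)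

/-- Transition intensities between distinct states of the tandem network with level-zero removal
rates `ν`: arrivals `(k, i) → (k, i + 1)` at rate `λ`; service at the first queue
`(k, i) → (k + 1, i - 1)` at rate `μ₁`; service at the second queue `(k, i) → (k - 1, i)` at
rate `μ₂`; removals `(0, i) → (0, i - 1)` at rate `ν i`. -/
def tandemJumpRate (lam μ₁ μ₂ : ℝ) (ν : ℕ → ℝ) (x y : ℕ × ℕ) : ℝ :=
  (if y = (x.1, x.2 + 1) then lam else 0)
    + (if 1 ≤ x.2 ∧ y = (x.1 + 1, x.2 - 1) then μ₁ else 0)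
    + (if 1 ≤ x.1 ∧ y = (x.1 - 1, x.2) then μ₂ else 0)
    + (if x.1 = 0 ∧ 1 ≤ x.2 ∧ y = (0, x.2 - 1) then ν x.2 else 0)

/-- The total rate of leaving a state. -/
def tandemExitRate (lam μ₁ μ₂ : ℝ) (ν : ℕ → ℝ) (x : ℕ × ℕ) : ℝ :=
  lam + (if 1 ≤ x.2 then μ₁ else 0) + (if 1 ≤ x.1 then μ₂ else 0)
    + (if x.1 = 0 ∧ 1 ≤ x.2 then ν x.2 else 0)

/-- The generator of the tandem network with level-zero removal rates `ν`. -/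
def tandemGenerator (lam μ₁ μ₂ : ℝ) (ν : ℕ → ℝ) (x y : ℕ × ℕ) : ℝ :=
  if x = y then -tandemExitRate lam μ₁ μ₂ ν x else tandemJumpRate lam μ₁ μ₂ ν x y

end

noncomputable section

/-! The product $c z^K w_i$ solves the balance equations by construction: the recursion for
`tandemW` is balance at positive levels, the recursion for `removalRate` is balance at level zero.
What remains is positivity, summability and a theory of chains with bounded exit rates.

Positivity rests on the characteristic polynomial $\mu_1x^2-(\lambda+\mu_1+\mu_2(1-z))zx+\lambda z$.
Its discriminant is nonnegative because, in the variable $\sqrt z$, the condition is a bound on a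
concave cubic between two points (`tandem_discriminant`). Its roots satisfy $z\le s\le r<1$
(`tandem_exists_roots`), so $w_{k+1}=rw_k+s^k(s-z)$ (`tandemW_succ`) gives a positive summable
vector. Summing balance over levels yields $(1-z)\nu_{i+1}w_{i+1}=\lambda w_i-\mu_1w_{i+1}$
(`removalRate_succ_mul`), which shows the sign of the removal rates and bounds them.

A bounded generator exponentiates on $\ell^1$ to a transition function
(`exists_isTransitionFunction`). For an arbitrary transition function with that generator,
infinitesimal invariance implies invariance (`semigroup_eq_self`). Convergence comes from
compactness of the order intervals $|f|\le Cp$ and strict contraction on vectors of total zero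
(`tendsto_norm_semigroup_nat`), and uniqueness follows from convergence. -/

/-- The Banach space of absolutely summable families. -/
abbrev Ell1 (S : Type*) : Type _ := lp (fun _ : S => ℝ) 1

/-! ### Operators on $\ell^1$ given by bounded families of rows. -/

namespace Ell1

variable {S : Type*} {E : Type*} [NormedAddCommGroup E] [NormedSpace ℝ E]

theorem summable (f : Ell1 S) : Summable (fun x => f x) :=
  (lp.memℓp f).summable_of_one

theorem summable_abs (f : Ell1 S) : Summable (fun x => |f x|) := f.summable.abs

theorem norm_eq (f : Ell1 S) : ‖f‖ = ∑' x, |f x| := by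
  rw [lp.norm_eq_tsum_rpow (by simp)]
  simp

/-- The element of `ℓ¹` given by a summable family. -/
def ofSummable (f : S → ℝ) (hf : Summable f) : Ell1 S :=
  ⟨f, memℓp_gen (by simpa using hf.abs)⟩

@[simp] theorem ofSummable_apply (f : S → ℝ) (hf : Summable f) (x : S) :
    ofSummable f hf x = f x := rfl

theorem norm_tsum_smul_le (a : S → E) (C : ℝ) (h : ∀ x, ‖a x‖ ≤ C) (f : Ell1 S) :
    ‖∑' x, f x • a x‖ ≤ C * ‖f‖ := by
  rw [norm_eq, ← tsum_mul_left]
  refine tsum_of_norm_bounded (f.summable_abs.mul_left C).hasSum fun x => ?_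
  rw [norm_smul, Real.norm_eq_abs, mul_comm]
  exact mul_le_mul_of_nonneg_right (h x) (abs_nonneg _)

variable [CompleteSpace E]

theorem summable_smul (a : S → E) (C : ℝ) (h : ∀ x, ‖a x‖ ≤ C) (f : Ell1 S) :
    Summable (fun x => f x • a x) := by
  refine Summable.of_norm_bounded (f.summable_abs.mul_right C) fun x => ?_
  rw [norm_smul, Real.norm_eq_abs]
  exact mul_le_mul_of_nonneg_left (h x) (abs_nonneg _)

/-- The operator on `ℓ¹` that sends the `x`-th unit vector to `a x`. -/
def lift (a : S → E) (C : ℝ) (h : ∀ x, ‖a x‖ ≤ C) : Ell1 S →L[ℝ] E :=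
  LinearMap.mkContinuous
    { toFun := fun f => ∑' x, f x • a x
      map_add' := fun f g => by
        rw [← (summable_smul a C h f).tsum_add (summable_smul a C h g)]
        exact tsum_congr fun x => by rw [lp.coeFn_add, Pi.add_apply, add_smul]
      map_smul' := fun c f => by
        rw [RingHom.id_apply, ← (summable_smul a C h f).tsum_const_smul c]
        exact tsum_congr fun x => by
          rw [lp.coeFn_smul, Pi.smul_apply, smul_assoc] }
    C (norm_tsum_smul_le a C h)

theorem hasSum_lift (a : S → E) (C : ℝ) (h : ∀ x, ‖a x‖ ≤ C) (f : Ell1 S) :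
    HasSum (fun x => f x • a x) (lift a C h f) :=
  (summable_smul a C h f).hasSum

theorem norm_lift_apply_le (a : S → E) (C : ℝ) (h : ∀ x, ‖a x‖ ≤ C) (f : Ell1 S) :
    ‖lift a C h f‖ ≤ C * ‖f‖ :=
  norm_tsum_smul_le a C h f

/-- Evaluation at a point. -/
abbrev eval (y : S) : Ell1 S →L[ℝ] ℝ := lp.evalCLM ℝ (fun _ => ℝ) 1 y

theorem hasSum_lift_apply (a : S → Ell1 S) (C : ℝ) (h : ∀ x, ‖a x‖ ≤ C) (f : Ell1 S) (y : S) :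
    HasSum (fun x => f x * a x y) (lift a C h f y) :=
  (hasSum_lift a C h f).mapL (eval y)

/-- The sum of all coordinates. -/
abbrev total (S : Type*) : Ell1 S →L[ℝ] ℝ := lp.tsumCLM ℝ S ℝ

theorem hasSum_total (f : Ell1 S) : HasSum (fun x => f x) (total S f) :=
  f.summable.hasSum

variable [DecidableEq S]

/-- The unit vector at `x`. -/
abbrev unit (x : S) : Ell1 S := lp.single 1 x 1

theorem unit_apply (x y : S) : unit x y = if x = y then 1 else 0 := by
  simp [Pi.single_apply, eq_comm]

theorem total_unit (x : S) : total S (unit x) = 1 := by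
  refine (hasSum_total (unit x)).unique ?_
  simpa only [unit_apply, eq_comm] using hasSum_ite_eq x (1 : ℝ)

theorem hasSum_unit (f : Ell1 S) : HasSum (fun x => f x • unit x) f := by
  have := lp.hasSum_single (by simp) f
  refine this.congr_fun ?_ 
  intro x
  rw [← lp.single_smul, smul_eq_mul, mul_one]

theorem lift_unit (a : S → E) (C : ℝ) (h : ∀ x, ‖a x‖ ≤ C) (x : S) :
    lift a C h (unit x) = a x := by
  refine (hasSum_lift a C h (unit x)).unique ?_
  convert hasSum_ite_eq x (a x) using 2 with y
  rw [unit_apply]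
  by_cases hxy : x = y
  · subst hxy; simp
  · simp [hxy, Ne.symm hxy]

theorem ext_unit {F : Type*} [NormedAddCommGroup F] [NormedSpace ℝ F] {T U : Ell1 S →L[ℝ] F} (h : ∀ x, T (unit x) = U (unit x)) : T = U := by
  ext f
  refine ((hasSum_unit f).mapL T).unique ?_
  convert (hasSum_unit f).mapL U using 2 with x
  rw [map_smul, map_smul, h]

end Ell1

/-! ### Existence of a transition function for a bounded generator. -/

open Ell1 NormedSpace

/-- The transition function is $e^{tA}$, where $A$ is right multiplication by $Q$ on $\ell^1$. Each
row of $Q$ sums to zero, so its norm is $-2Q(x,x)\le 2C$. -/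
theorem exists_isTransitionFunction {S : Type*} [DecidableEq S] (Q : S → S → ℝ) (C : ℝ)
    (hoff : ∀ x y, x ≠ y → 0 ≤ Q x y) (hdiag : ∀ x, -Q x x ≤ C)
    (hsum : ∀ x, HasSum (Q x) 0) : ∃ P, IsTransitionFunction Q P := by
  let a : S → Ell1 S := fun x => ofSummable (Q x) (hsum x).summable
  have ha : ∀ x, ‖a x‖ ≤ 2 * C := fun x => by
    have h1 : HasSum (fun y => |a x y|) (0 + -2 * Q x x) := by
      refine ((hsum x).add (hasSum_ite_eq x (-2 * Q x x))).congr_fun ?_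
      intro y
      have hx0 : Q x x ≤ 0 := by
        have := (hsum x).sub (hasSum_ite_eq x (Q x x))
        have := this.nonneg (fun y => by
          rcases eq_or_ne y x with rfl | h
          · simp
          · simpa [h] using hoff x y h.symm)
        linarith
      rcases eq_or_ne y x with rfl | h
      · simp [a, abs_of_nonpos hx0]; ring
      · simp [a, h, abs_of_nonneg (hoff x y h.symm)]
    rw [norm_eq, h1.tsum_eq]
    linarith [hdiag x]
  let A : Ell1 S →L[ℝ] Ell1 S := lift a _ ha
  have hA : ∀ x, A (unit x) = a x := lift_unit a _ ha
  let _ : NormedAlgebra ℚ (Ell1 S →L[ℝ] Ell1 S) := NormedAlgebra.restrictScalars ℚ ℝ _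
  let G : ℝ → (Ell1 S →L[ℝ] Ell1 S) := fun t => exp (t • A)
  have hG0 : G 0 = 1 := by simp [G]
  have hGadd : ∀ s t, G (s + t) = G t * G s := fun s t => by
    simp only [G]
    rw [add_comm, add_smul, exp_add_of_commute]
    exact ((Commute.refl A).smul_left _).smul_right _
  have htotA : (total S).comp A = 0 := ext_unit fun x => by
    rw [ContinuousLinearMap.comp_apply, hA]
    exact (hsum x).tsum_eq.trans (by simp)
  -- Total mass is preserved: every term of the exponential series but the zeroth is killed by
  -- `htotA`.
  have htot : ∀ t f, total S (G t f) = total S f := fun t f => by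
    have h1 := (exp_series_hasSum_exp' (𝕂 := ℝ) (t • A)).mapL
      (((total S).comp (ContinuousLinearMap.apply ℝ (Ell1 S) f)))
    have h2 : HasSum (fun n : ℕ => if n = 0 then total S f else 0) (total S f) :=
      hasSum_ite_eq 0 _
    refine h1.unique ?_
    convert h2 using 2 with n
    rcases n with _ | n
    · simp
    · have : total S (((t • A) ^ (n + 1)) f) = 0 := by
        rw [pow_succ']
        change total S (t • A (((t • A) ^ n) f)) = 0
        rw [map_smul, ← ContinuousLinearMap.comp_apply, htotA]
        simp
      rw [map_smul, ContinuousLinearMap.comp_apply, ContinuousLinearMap.apply_apply, this]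
      simp
  -- Uniformization: the shift by $C$ makes all entries nonnegative, and $e^{tA}=e^{-tC}e^{tB}$.
  let B : Ell1 S →L[ℝ] Ell1 S := A + C • 1
  have hB : ∀ f : Ell1 S, (∀ x, 0 ≤ f x) → ∀ y, 0 ≤ B f y := fun f hf y => by
    have h1 := (hasSum_lift_apply a _ ha f y).add (hasSum_ite_eq y (C * f y))
    have h2 : B f y = lift a _ ha f y + C * f y := rfl
    rw [h2]
    refine h1.nonneg fun x => ?_
    rcases eq_or_ne x y with rfl | h
    · simp only [a, ofSummable_apply, if_true]
      nlinarith [hdiag x, hf x]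
    · simpa [h, a] using mul_nonneg (hf x) (hoff x y h)
  have hBpow : ∀ n (f : Ell1 S), (∀ x, 0 ≤ f x) → ∀ y, 0 ≤ (B ^ n) f y := by
    intro n
    induction n with
    | zero => intro f hf y; simpa using hf y
    | succ n ih => intro f hf y; rw [pow_succ]; exact ih _ (hB f hf) y
  have hnonneg : ∀ t, 0 ≤ t → ∀ f : Ell1 S, (∀ x, 0 ≤ f x) → ∀ y, 0 ≤ G t f y := by
    intro t ht f hf y
    have h1 : G t = Real.exp (-(t * C)) • exp (t • B) := by
      have e : t • A = algebraMap ℝ (Ell1 S →L[ℝ] Ell1 S) (-(t * C)) + t • B := by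
        simp only [B, Algebra.algebraMap_eq_smul_one, smul_add, neg_smul, mul_smul]
        abel
      simp only [G]
      rw [e, exp_add_of_commute (Algebra.commutes _ _), ← algebraMap_exp_comm,
        ← Real.exp_eq_exp_ℝ, Algebra.algebraMap_eq_smul_one, smul_mul_assoc, one_mul]
    have h2 := (exp_series_hasSum_exp' (𝕂 := ℝ) (t • B)).mapL
      ((eval y).comp (ContinuousLinearMap.apply ℝ (Ell1 S) f))
    have h3 : 0 ≤ exp (t • B) f y := h2.nonneg fun n => by
      have : 0 ≤ (n.factorial : ℝ)⁻¹ * (t ^ n * (B ^ n) f y) :=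
        mul_nonneg (by positivity) (mul_nonneg (by positivity) (hBpow n f hf y))
      rw [smul_pow]
      exact this
    rw [h1]
    exact mul_nonneg (Real.exp_pos _).le h3
  refine ⟨fun t x y => G t (unit x) y, ?_, ?_, ?_, ?_, ?_⟩
  · exact fun t ht x y => hnonneg t ht _ (fun u => by rw [unit_apply]; split_ifs <;> simp) y
  · intro t _ x
    have h := hasSum_total (G t (unit x))
    rw [htot] at h
    rwa [total_unit] at h
  · intro x y
    simp only [hG0]
    exact unit_apply x y
  · intro s t _ _ x y
    have h := (hasSum_unit (G s (unit x))).mapL ((eval y).comp (G t))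
    simp only [hGadd]
    exact h.congr_fun fun u => by rw [map_smul]; rfl
  · intro x y
    have h := hasDerivAt_exp_smul_const (𝕂 := ℝ) A 0
    have h2 := ((eval y).comp (ContinuousLinearMap.apply ℝ (Ell1 S) (unit x))).hasFDerivAt
      (x := exp ((0 : ℝ) • A)) |>.comp_hasDerivAt (0 : ℝ) h
    have h3 : ((eval y).comp (ContinuousLinearMap.apply ℝ (Ell1 S) (unit x)))
        (exp ((0 : ℝ) • A) * A) = Q x y := by
      rw [zero_smul, exp_zero, one_mul]
      change A (unit x) y = _
      rw [hA]
      rfl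
    rw [h3] at h2
    exact h2.hasDerivWithinAt

/-! ### Arbitrary transition functions: positivity, the $\ell^1$ semigroup, invariance. -/

namespace Ell1

variable {S : Type*}

theorem tendsto_norm_sub_of_dominated {ι : Type*} {l : Filter ι} {f : ι → Ell1 S} {g : Ell1 S}
    {b : S → ℝ} (hb : Summable b) (hf : ∀ i x, |f i x| ≤ b x) (hg : ∀ x, |g x| ≤ b x)
    (h : ∀ x, Tendsto (fun i => f i x) l (𝓝 (g x))) : Tendsto f l (𝓝 g) := by
  rw [tendsto_iff_norm_sub_tendsto_zero]
  simp only [norm_eq]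
  have key := tendsto_tsum_of_dominated_convergence (𝓕 := l) (f := fun i x => |(f i - g) x|)
    (g := fun _ => 0) (hb.mul_left 2) (fun x => by
      have := ((h x).sub_const (g x)).abs
      simpa using this) (Eventually.of_forall fun i x => by
      rw [Real.norm_eq_abs, abs_abs, lp.coeFn_sub, Pi.sub_apply]
      have := abs_sub (f i x) (g x)
      linarith [hf i x, hg x])
  simpa using key

end Ell1

theorem tendsto_div_add_one_nhdsGT_zero {t : ℝ} (ht : 0 < t) :
    Tendsto (fun n : ℕ => t / (n + 1 : ℝ)) atTop (𝓝[>] 0) := by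
  refine tendsto_nhdsWithin_iff.2 ⟨?_, Eventually.of_forall fun n => ?_⟩
  · have := (tendsto_one_div_add_atTop_nhds_zero_nat (𝕜 := ℝ)).const_mul t
    simpa [div_eq_mul_inv] using this
  · exact div_pos ht (by positivity)

namespace IsTransitionFunction

variable {S : Type*} [DecidableEq S] {Q : S → S → ℝ} {P : ℝ → S → S → ℝ}
  (hP : IsTransitionFunction Q P)

include hP

theorem le_one {t : ℝ} (ht : 0 ≤ t) (x y : S) : P t x y ≤ 1 :=
  le_hasSum (hP.honest t ht x) y fun u _ => hP.nonneg t ht x u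

theorem add_le_one {t : ℝ} (ht : 0 ≤ t) (x : S) {y u : S} (hyu : y ≠ u) :
    P t x y + P t x u ≤ 1 := by
  rw [← Finset.sum_pair hyu (f := fun v => P t x v)]
  exact sum_le_hasSum _ (fun v _ => hP.nonneg t ht x v) (hP.honest t ht x)

theorem mul_le_add {s t : ℝ} (hs : 0 ≤ s) (ht : 0 ≤ t) (x u y : S) :
    P s x u * P t u y ≤ P (s + t) x y :=
  le_hasSum (hP.chapman_kolmogorov s t hs ht x y) u fun v _ =>
    mul_nonneg (hP.nonneg s hs x v) (hP.nonneg t ht v y)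

theorem pow_le_diag {t : ℝ} (ht : 0 ≤ t) (x : S) (n : ℕ) : P t x x ^ n ≤ P (n * t) x x := by
  induction n with
  | zero => simp [hP.initial]
  | succ n ih =>
    have h := hP.mul_le_add (by positivity : 0 ≤ (n : ℝ) * t) ht x x x
    rw [pow_succ]
    push_cast
    rw [add_mul, one_mul]
    exact (mul_le_mul_of_nonneg_right ih (hP.nonneg t ht x x)).trans h

theorem tendsto_slope (x y : S) :
    Tendsto (fun h => (P h x y - P 0 x y) / h) (𝓝[>] 0) (𝓝 (Q x y)) := by
  have := hasDerivWithinAt_iff_tendsto_slope.1 (hP.generator x y)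
  rw [Set.Ici_sdiff_left] at this
  refine this.congr fun h => ?_
  simp [slope_def_field]

/-- Bernoulli's inequality applied to $P_{t/n}(x,x)^n\le P_t(x,x)$, with $n\to\infty$. It turns the
derivative at zero into a bound at every time. -/
theorem one_add_mul_le_diag {t : ℝ} (ht : 0 ≤ t) (x : S) : 1 + t * Q x x ≤ P t x x := by
  rcases ht.eq_or_lt with rfl | ht
  · simp [hP.initial]
  have hlim := tendsto_div_add_one_nhdsGT_zero ht
  have h1 := (((hP.tendsto_slope x x).comp hlim).const_mul t).const_add 1
  refine le_of_tendsto h1 (Eventually.of_forall fun n => ?_)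
  have hn : (0 : ℝ) < n + 1 := by positivity
  have hpos : 0 ≤ t / (n + 1 : ℝ) := (div_pos ht hn).le
  have h2 := hP.pow_le_diag hpos x (n + 1)
  have h3 := one_add_mul_le_pow (a := P (t / (n + 1)) x x - 1)
    (by linarith [hP.nonneg _ hpos x x]) (n + 1)
  have e : ((n + 1 : ℕ) : ℝ) * (t / (n + 1)) = t := by push_cast; field_simp
  rw [e] at h2
  rw [add_sub_cancel] at h3
  refine le_trans (le_of_eq ?_) (h3.trans h2)
  simp only [Function.comp_apply, hP.initial, if_true]
  push_cast
  field_simp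

theorem diag_pos {t : ℝ} (ht : 0 ≤ t) (x : S) : 0 < P t x x := by
  obtain ⟨n, hn⟩ := exists_nat_gt (t * |Q x x|)
  have hn' : (0 : ℝ) < n + 1 := by positivity
  have hpos : 0 ≤ t / (n + 1 : ℝ) := div_nonneg ht hn'.le
  have h1 := hP.one_add_mul_le_diag hpos x
  have h2 := hP.pow_le_diag hpos x (n + 1)
  have e : ((n + 1 : ℕ) : ℝ) * (t / (n + 1)) = t := by push_cast; field_simp
  rw [e] at h2
  refine lt_of_lt_of_le (pow_pos (lt_of_lt_of_le ?_ h1) _) h2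
  have h3 : t / (n + 1) * |Q x x| < 1 := by
    rw [div_mul_eq_mul_div, div_lt_one hn']
    linarith
  have h4 := mul_le_mul_of_nonneg_left (neg_abs_le (Q x x)) hpos
  linarith

/-- The derivative forces a jump with positive probability by some small time $s<t$; the chain may
then be at $y$ again after the remaining $t-s$. -/
theorem pos_of_generator_pos {x y : S} (hxy : x ≠ y) (h : 0 < Q x y) {t : ℝ} (ht : 0 < t) :
    0 < P t x y := by
  have h1 := (hP.tendsto_slope x y).eventually (lt_mem_nhds h)
  have h2 : ∀ᶠ s : ℝ in 𝓝[>] 0, s < t := mem_nhdsWithin_of_mem_nhds (Iio_mem_nhds ht)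
  obtain ⟨s, ⟨hs1, hst⟩, hs⟩ := ((h1.and h2).and self_mem_nhdsWithin).exists
  rw [hP.initial, if_neg hxy, sub_zero] at hs1
  have hs0 : 0 < s := hs
  have hsP : 0 < P s x y := by
    by_contra hcon
    exact absurd hs1 (not_lt.2 (div_nonpos_of_nonpos_of_nonneg (not_lt.1 hcon) hs0.le))
  have h3 := hP.mul_le_add hs0.le (sub_nonneg.2 hst.le) x y y
  rw [add_sub_cancel] at h3
  exact (mul_pos hsP (hP.diag_pos (sub_nonneg.2 hst.le) y)).trans_le h3

theorem pos_of_reflTransGen {x y : S}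
    (h : Relation.ReflTransGen (fun u v => u ≠ v ∧ 0 < Q u v) x y) :
    ∀ t, 0 < t → 0 < P t x y := by
  induction h with
  | refl => exact fun t ht => hP.diag_pos ht.le x
  | @tail u v _ huv ih =>
    intro t ht
    have h2 := half_pos ht
    have := hP.mul_le_add h2.le h2.le x u v
    rw [add_halves] at this
    exact (mul_pos (ih _ h2) (hP.pos_of_generator_pos huv.1 huv.2 h2)).trans_le this

/-- The row of `P t` at `x`, as an element of `ℓ¹`. -/
def row (t : ℝ) (x : S) : Ell1 S :=
  -- `P` is unconstrained at negative times; the truncation makes every row summable.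
  ofSummable (P (max t 0) x) (hP.honest _ (le_max_right _ _) x).summable

theorem norm_row (t : ℝ) (x : S) : ‖hP.row t x‖ ≤ 1 := by
  rw [norm_eq]
  have h : ∀ y, |hP.row t x y| = P (max t 0) x y := fun y =>
    abs_of_nonneg (hP.nonneg _ (le_max_right _ _) x y)
  simp only [h]
  exact (hP.honest _ (le_max_right _ _) x).tsum_eq.le

/-- The semigroup of contractions of `ℓ¹` given by a transition function. -/
def semigroup (t : ℝ) : Ell1 S →L[ℝ] Ell1 S := lift (hP.row t) 1 (hP.norm_row t)

theorem hasSum_semigroup {t : ℝ} (ht : 0 ≤ t) (f : Ell1 S) (y : S) :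
    HasSum (fun x => f x * P t x y) (hP.semigroup t f y) := by
  have : HasSum _ (hP.semigroup t f y) :=
    hasSum_lift_apply (hP.row t) 1 (hP.norm_row t) f y
  simpa only [row, ofSummable_apply, max_eq_left ht] using this

theorem semigroup_unit {t : ℝ} (ht : 0 ≤ t) (x y : S) : hP.semigroup t (unit x) y = P t x y := by
  rw [semigroup, lift_unit]
  simp only [row, ofSummable_apply, max_eq_left ht]

theorem norm_semigroup_le (t : ℝ) (f : Ell1 S) : ‖hP.semigroup t f‖ ≤ ‖f‖ := by
  rw [← one_mul ‖f‖]
  exact norm_lift_apply_le (hP.row t) 1 (hP.norm_row t) f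

theorem semigroup_add {s t : ℝ} (hs : 0 ≤ s) (ht : 0 ≤ t) (f : Ell1 S) :
    hP.semigroup (s + t) f = hP.semigroup t (hP.semigroup s f) := by
  suffices h : hP.semigroup (s + t) = (hP.semigroup t).comp (hP.semigroup s) by
    rw [h, ContinuousLinearMap.comp_apply]
  refine ext_unit fun x => lp.ext (funext fun y => ?_)
  rw [hP.semigroup_unit (add_nonneg hs ht), ContinuousLinearMap.comp_apply]
  refine (hP.chapman_kolmogorov s t hs ht x y).unique ?_
  have := hP.hasSum_semigroup ht (hP.semigroup s (unit x)) y
  simpa only [hP.semigroup_unit hs] using this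

theorem semigroup_zero (f : Ell1 S) : hP.semigroup 0 f = f := by
  suffices h : hP.semigroup 0 = ContinuousLinearMap.id ℝ _ by
    rw [h, ContinuousLinearMap.id_apply]
  refine ext_unit fun x => lp.ext (funext fun y => ?_)
  rw [hP.semigroup_unit le_rfl, hP.initial, ContinuousLinearMap.id_apply, unit_apply]

theorem total_semigroup {t : ℝ} (ht : 0 ≤ t) (f : Ell1 S) :
    total S (hP.semigroup t f) = total S f := by
  suffices h : (total S).comp (hP.semigroup t) = total S by
    rw [← ContinuousLinearMap.comp_apply, h]
  refine ext_unit fun x => ?_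
  rw [ContinuousLinearMap.comp_apply, total_unit]
  refine (hasSum_total _).unique ?_
  simpa only [hP.semigroup_unit ht] using hP.honest t ht x

theorem abs_semigroup_le {t : ℝ} (ht : 0 ≤ t) {f g : Ell1 S} (h : ∀ x, |f x| ≤ g x) (y : S) :
    |hP.semigroup t f y| ≤ hP.semigroup t g y := by
  rw [← (hP.hasSum_semigroup ht f y).tsum_eq]
  rw [← Real.norm_eq_abs]
  refine tsum_of_norm_bounded (hP.hasSum_semigroup ht g y) fun x => ?_
  rw [Real.norm_eq_abs, abs_mul, abs_of_nonneg (hP.nonneg t ht x y)]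
  exact mul_le_mul_of_nonneg_right (h x) (hP.nonneg t ht x y)

section Invariant

variable {p : Ell1 S} (hp : ∀ x, 0 ≤ p x) {C : ℝ} (hC : ∀ x, -Q x x ≤ C)
  (hinv : ∀ y, HasSum (fun x => p x * Q x y) 0)

include hC in
theorem abs_slope_le {h : ℝ} (hh : 0 < h) (x y : S) : |(P h x y - P 0 x y) / h| ≤ C := by
  have h1 := hP.one_add_mul_le_diag hh.le x
  have h2 := mul_le_mul_of_nonneg_left (hC x) hh.le
  rw [abs_div, abs_of_pos hh, div_le_iff₀ hh, hP.initial]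
  rcases eq_or_ne x y with rfl | hxy
  · rw [if_pos rfl, abs_sub_comm, abs_of_nonneg (by linarith [hP.le_one hh.le x x])]
    linarith
  · rw [if_neg hxy, sub_zero, abs_of_nonneg (hP.nonneg h hh.le x y)]
    linarith [hP.add_le_one hh.le x hxy]

include hp hC hinv in
-- A Scheffé argument. The quotients tend to $(pQ)(y)=0$ coordinatewise; their negative parts are
-- dominated by $Cp$, hence tend to zero in $\ell^1$; since the total is zero, the norm is twice the
-- mass of the negative part.
theorem tendsto_norm_semigroup_sub_div :
    Tendsto (fun h => ‖hP.semigroup h p - p‖ / h) (𝓝[>] 0) (𝓝 0) := by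
  have hev : ∀ᶠ h : ℝ in 𝓝[>] 0, 0 < h := self_mem_nhdsWithin
  have hpt : ∀ y, Tendsto (fun h => (hP.semigroup h p y - p y) / h) (𝓝[>] 0) (𝓝 0) := by
    intro y
    have key := tendsto_tsum_of_dominated_convergence (𝓕 := 𝓝[>] (0 : ℝ))
      (f := fun h x => p x * ((P h x y - P 0 x y) / h)) (g := fun x => p x * Q x y)
      (p.summable.mul_right C) (fun x => (hP.tendsto_slope x y).const_mul (p x))
      (hev.mono fun h hh x => by
        rw [norm_mul, Real.norm_eq_abs, Real.norm_eq_abs, abs_of_nonneg (hp x)]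
        exact mul_le_mul_of_nonneg_left (hP.abs_slope_le hC hh x y) (hp x))
    rw [(hinv y).tsum_eq] at key
    refine key.congr' (hev.mono fun h hh => ?_)
    refine HasSum.tsum_eq ?_
    have h1 := hP.hasSum_semigroup le_rfl p y
    rw [hP.semigroup_zero] at h1
    refine (((hP.hasSum_semigroup hh.le p y).sub h1).div_const h).congr_fun fun x => ?_
    rw [← mul_sub, mul_div_assoc]
  have key := tendsto_tsum_of_dominated_convergence (𝓕 := 𝓝[>] (0 : ℝ))
    (f := fun h y => max (-((hP.semigroup h p y - p y) / h)) 0) (g := fun _ => 0)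
    (p.summable.mul_right C) (fun y => by
      have := (hpt y).neg.max (tendsto_const_nhds (x := (0 : ℝ)))
      simpa using this)
    (hev.mono fun h hh y => by
      have hCy : 0 ≤ p y * C := by
        have := (abs_nonneg _).trans (hP.abs_slope_le hC hh y y)
        exact mul_nonneg (hp y) this
      rw [Real.norm_eq_abs, abs_of_nonneg (le_max_right _ _)]
      refine max_le ?_ hCy
      rw [← neg_div, div_le_iff₀ hh]
      have h1 : p y * P h y y ≤ hP.semigroup h p y :=
        le_hasSum (hP.hasSum_semigroup hh.le p y) y fun x _ =>
          mul_nonneg (hp x) (hP.nonneg h hh.le x y)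
      have h2 := mul_le_mul_of_nonneg_left (hP.one_add_mul_le_diag hh.le y) (hp y)
      have h3 := mul_le_mul_of_nonneg_left (hC y) (mul_nonneg (hp y) hh.le)
      linarith)
  rw [tsum_zero] at key
  have key2 := key.const_mul 2
  rw [mul_zero] at key2
  refine key2.congr' (hev.mono fun h hh => ?_)
  have h1 : HasSum (fun y => (hP.semigroup h p - p) y) 0 := by
    have := hasSum_total (hP.semigroup h p - p)
    rwa [map_sub, hP.total_semigroup hh.le, sub_self] at this
  have h2 := h1.div_const h
  have h3 := (hP.semigroup h p - p).summable_abs.hasSum.div_const h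
  have h4 := ((h3.sub h2).div_const 2).tsum_eq
  have h5 : ∑' y, max (-((hP.semigroup h p y - p y) / h)) 0 =
      (∑' y, |(hP.semigroup h p - p) y|) / h / 2 := by
    rw [zero_div, sub_zero] at h4
    rw [← h4]
    refine tsum_congr fun y => ?_
    rw [lp.coeFn_sub, Pi.sub_apply, ← abs_of_pos hh, ← abs_div, abs_of_pos hh]
    rcases le_total 0 ((hP.semigroup h p y - p y) / h) with h0 | h0
    · rw [abs_of_nonneg h0, max_eq_right (by linarith)]; ring
    · rw [abs_of_nonpos h0, max_eq_left (by linarith)]; ring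
  have h6 : ‖hP.semigroup h p - p‖ = ∑' y, |(hP.semigroup h p - p) y| := norm_eq _
  beta_reduce
  rw [h5, h6]
  ring

theorem norm_semigroup_nsmul_sub_le {t : ℝ} (ht : 0 ≤ t) (f : Ell1 S) (n : ℕ) :
    ‖hP.semigroup (n * t) f - f‖ ≤ n * ‖hP.semigroup t f - f‖ := by
  induction n with
  | zero => simp [hP.semigroup_zero]
  | succ n ih =>
    push_cast
    rw [add_mul, one_mul, hP.semigroup_add (by positivity) ht]
    have e : hP.semigroup t (hP.semigroup (n * t) f) - f =
        hP.semigroup t (hP.semigroup (n * t) f - f) + (hP.semigroup t f - f) := by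
      rw [map_sub]; abel
    rw [e, add_mul, one_mul]
    exact (norm_add_le _ _).trans (add_le_add_left ((hP.norm_semigroup_le _ _).trans ih) _)

include hp hC hinv in
-- Cutting $[0,t]$ into $n$ pieces, the contraction property bounds the total change by $n$ times
-- the change over $t/n$, which is $o(1)$.
theorem semigroup_eq_self {t : ℝ} (ht : 0 ≤ t) : hP.semigroup t p = p := by
  rcases ht.eq_or_lt with rfl | ht
  · exact hP.semigroup_zero p
  have hlim := tendsto_div_add_one_nhdsGT_zero ht
  have h1 := ((hP.tendsto_norm_semigroup_sub_div hp hC hinv).comp hlim).const_mul t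
  rw [mul_zero] at h1
  rw [← sub_eq_zero, ← norm_le_zero_iff]
  refine ge_of_tendsto h1 (Eventually.of_forall fun n => ?_)
  have hn : (0 : ℝ) < n + 1 := by positivity
  have h2 := hP.norm_semigroup_nsmul_sub_le (div_pos ht hn).le p (n + 1)
  have e : ((n + 1 : ℕ) : ℝ) * (t / (n + 1)) = t := by push_cast; field_simp
  rw [e] at h2
  refine h2.trans (le_of_eq ?_)
  simp only [Function.comp_apply]
  push_cast
  field_simp

include hp hC hinv in
theorem isStationaryDistribution (hp1 : HasSum (fun x => p x) 1) :
    IsStationaryDistribution P (fun x => p x) where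
  nonneg := hp
  total := hp1
  invariant t ht y := by
    have := hP.hasSum_semigroup ht p y
    rwa [hP.semigroup_eq_self hp hC hinv ht] at this

end Invariant

end IsTransitionFunction

/-! ### Convergence to the invariant distribution and its uniqueness. -/

namespace IsTransitionFunction

variable {S : Type*} [DecidableEq S] {Q : S → S → ℝ} {P : ℝ → S → S → ℝ}
  (hP : IsTransitionFunction Q P)

include hP

/-- Equality of norms forces equality in the triangle inequality at $o$. As every $P_t(x,o)$ is
positive, $g$ has constant sign, and total zero makes it vanish. -/
theorem eq_zero_of_norm_semigroup_eq {t : ℝ} (ht : 0 ≤ t) {o : S} (ho : ∀ x, 0 < P t x o)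
    {g : Ell1 S} (hg : total S g = 0) (hnorm : ‖hP.semigroup t g‖ = ‖g‖) : g = 0 := by
  let a : Ell1 S := ofSummable (fun x => |g x|) g.summable_abs
  have hle : ∀ y, |hP.semigroup t g y| ≤ hP.semigroup t a y :=
    hP.abs_semigroup_le ht (g := a) fun x => le_rfl
  have hsum : HasSum (fun y => hP.semigroup t a y - |hP.semigroup t g y|) 0 := by
    have h1 := hasSum_total (hP.semigroup t a)
    rw [hP.total_semigroup ht, (hasSum_total a).tsum_eq.symm] at h1
    have h2 := (hP.semigroup t g).summable_abs.hasSum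
    rw [← norm_eq, hnorm, norm_eq] at h2
    simpa [a] using h1.sub h2
  have heq : |hP.semigroup t g o| = hP.semigroup t a o := by
    have := (hasSum_zero_iff_of_nonneg fun y => sub_nonneg.2 (hle y)).1 hsum
    exact (sub_eq_zero.1 (congrFun this o)).symm
  have hS := hP.hasSum_semigroup ht g o
  have hSa := hP.hasSum_semigroup ht a o
  have hg0 := hasSum_total g
  rw [hg] at hg0
  rcases le_total 0 (hP.semigroup t g o) with h0 | h0
  · rw [abs_of_nonneg h0] at heq
    have h1 := hSa.sub hS
    rw [heq, sub_self] at h1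
    have h2 := (hasSum_zero_iff_of_nonneg fun x => by
      change 0 ≤ a x * P t x o - g x * P t x o
      rw [← sub_mul]
      exact mul_nonneg (sub_nonneg.2 (le_abs_self (g x))) (ho x).le).1 h1
    have h3 : ∀ x, 0 ≤ g x := fun x => by
      have : a x * P t x o - g x * P t x o = 0 := congrFun h2 x
      rw [← sub_mul] at this
      have := (mul_eq_zero.1 this).resolve_right (ho x).ne'
      exact abs_eq_self.1 (sub_eq_zero.1 this)
    exact lp.ext ((hasSum_zero_iff_of_nonneg h3).1 hg0)
  · rw [abs_of_nonpos h0] at heq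
    have h1 := hSa.add hS
    rw [← heq, neg_add_cancel] at h1
    have h2 := (hasSum_zero_iff_of_nonneg fun x => by
      change 0 ≤ a x * P t x o + g x * P t x o
      rw [← add_mul]
      exact mul_nonneg (by
        change 0 ≤ |g x| + g x
        linarith [neg_abs_le (g x)]) (ho x).le).1 h1
    have h3 : ∀ x, 0 ≤ -g x := fun x => by
      have : a x * P t x o + g x * P t x o = 0 := congrFun h2 x
      rw [← add_mul] at this
      have h4 : |g x| + g x = 0 := (mul_eq_zero.1 this).resolve_right (ho x).ne'
      linarith [abs_nonneg (g x)]
    have h4 := hg0.neg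
    rw [neg_zero] at h4
    have h5 := (hasSum_zero_iff_of_nonneg h3).1 h4
    exact lp.ext (funext fun x => by simpa using congrFun h5 x)

theorem norm_semigroup_antitone (f : Ell1 S) {s t : ℝ} (hs : 0 ≤ s) (hst : s ≤ t) :
    ‖hP.semigroup t f‖ ≤ ‖hP.semigroup s f‖ := by
  have := hP.semigroup_add hs (sub_nonneg.2 hst) f
  rw [add_sub_cancel] at this
  rw [this]
  exact hP.norm_semigroup_le _ _

section Limit

variable [Countable S] {p : Ell1 S} (hinv : ∀ t, 0 ≤ t → hP.semigroup t p = p)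
  {o : S} (ho : ∀ x, 0 < P 1 x o)

include hinv ho in
-- The orbit stays in the order interval $|f|\le Cp$, where coordinatewise limits are $\ell^1$
-- limits. The norms decrease to some $a$; a limit point $G$ and its image at time 1 both have norm
-- $a$, so $G=0$ and $a=0$.
theorem tendsto_norm_semigroup_nat {f : Ell1 S} {C : ℝ} (hf : ∀ x, |f x| ≤ C * p x)
    (hf0 : total S f = 0) :
    Tendsto (fun n : ℕ => ‖hP.semigroup n f‖) atTop (𝓝 0) := by
  have hdom : ∀ (n : ℕ) x, |hP.semigroup n f x| ≤ C * p x := fun n x => by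
    have h1 := hP.abs_semigroup_le (Nat.cast_nonneg n) (g := C • p) hf x
    rwa [map_smul, hinv n (Nat.cast_nonneg n)] at h1
  have hanti : Antitone (fun n : ℕ => ‖hP.semigroup n f‖) := fun m n hmn =>
    hP.norm_semigroup_antitone f (Nat.cast_nonneg m) (Nat.cast_le.2 hmn)
  have hlim := tendsto_atTop_ciInf hanti ⟨0, by rintro _ ⟨n, rfl⟩; exact norm_nonneg _⟩
  set a := ⨅ n : ℕ, ‖hP.semigroup n f‖
  have hcomp : IsCompact (Set.pi Set.univ fun x => Set.Icc (-(C * p x)) (C * p x)) :=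
    isCompact_univ_pi fun x => isCompact_Icc
  obtain ⟨g, hg, φ, hφ, hφg⟩ := hcomp.tendsto_subseq
    (x := fun (n : ℕ) x => hP.semigroup n f x) fun n x _ => abs_le.1 (hdom n x)
  have hgb : ∀ x, |g x| ≤ C * p x := fun x => abs_le.2 (hg x (Set.mem_univ x))
  have hgs : Summable g := Summable.of_norm_bounded (p.summable.mul_left C) hgb
  let G : Ell1 S := ofSummable g hgs
  have hG : Tendsto (fun k => hP.semigroup (φ k) f) atTop (𝓝 G) :=
    tendsto_norm_sub_of_dominated (p.summable.mul_left C) (fun k x => hdom (φ k) x) hgb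
      (fun x => (tendsto_pi_nhds.1 hφg) x)
  have hGa : ‖G‖ = a := tendsto_nhds_unique hG.norm (hlim.comp hφ.tendsto_atTop)
  have hG1 : ‖hP.semigroup 1 G‖ = a := by
    have h1 := (((hP.semigroup 1).continuous.tendsto G).comp hG).norm
    refine tendsto_nhds_unique h1
      ((hlim.comp ((tendsto_add_atTop_nat 1).comp hφ.tendsto_atTop)).congr fun k => ?_)
    simp only [Function.comp_apply]
    push_cast
    rw [hP.semigroup_add (Nat.cast_nonneg _) zero_le_one]
  have hG0 : total S G = 0 := by
    refine tendsto_nhds_unique (((total S).continuous.tendsto G).comp hG) ?_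
    refine tendsto_const_nhds.congr fun k => ?_
    rw [Function.comp_apply, hP.total_semigroup (Nat.cast_nonneg _), hf0]
  have := hP.eq_zero_of_norm_semigroup_eq zero_le_one ho hG0 (hG1.trans hGa.symm)
  rw [this, norm_zero] at hGa
  rwa [← hGa] at hlim

include hinv ho in
theorem tendsto_of_invariant (hp : ∀ x, 0 < p x) (hp1 : HasSum (fun x => p x) 1) (x y : S) :
    Tendsto (fun t => P t x y) atTop (𝓝 (p y)) := by
  have hp_le : ∀ u, p u ≤ 1 := fun u => le_hasSum hp1 u fun v _ => (hp v).le
  -- The term $1/p(x)$ in the constant dominates the unit vector at $x$, the other term dominates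
  -- $p$.
  have hnat := hP.tendsto_norm_semigroup_nat hinv ho (f := unit x - p) (C := 1 / p x + 1)
    (fun u => by
      rw [lp.coeFn_sub, Pi.sub_apply, unit_apply, add_mul, one_mul]
      have hpos : 0 ≤ 1 / p x * p u := mul_nonneg (one_div_pos.2 (hp x)).le (hp u).le
      split_ifs with h
      · subst h
        rw [one_div_mul_cancel (hp x).ne', abs_le]
        constructor <;> linarith [hp x, hp_le x]
      · rw [zero_sub, abs_neg, abs_of_pos (hp u)]
        linarith)
    (by rw [map_sub, total_unit, ← (hasSum_total p).unique hp1, sub_self])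
  have hfl := hnat.comp (tendsto_nat_floor_atTop (α := ℝ))
  rw [tendsto_iff_norm_sub_tendsto_zero]
  refine squeeze_zero' (Eventually.of_forall fun t => norm_nonneg _) ?_ hfl
  filter_upwards [eventually_ge_atTop 0] with t ht
  have h2 : P t x y - p y = hP.semigroup t (unit x - p) y := by
    rw [map_sub, hinv t ht, lp.coeFn_sub, Pi.sub_apply, hP.semigroup_unit ht]
  rw [h2]
  exact (lp.norm_apply_le_norm one_ne_zero _ y).trans
    (hP.norm_semigroup_antitone _ (Nat.cast_nonneg _) (Nat.floor_le ht))

end Limit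

theorem eq_of_isStationaryDistribution {p q : S → ℝ}
    (hlim : ∀ x y, Tendsto (fun t => P t x y) atTop (𝓝 (p y)))
    (hq : IsStationaryDistribution P q) : q = p := by
  funext y
  have key := tendsto_tsum_of_dominated_convergence (𝓕 := atTop)
    (f := fun t x => q x * P t x y) (g := fun x => q x * p y) hq.total.summable
    (fun x => (hlim x y).const_mul (q x))
    (by
      filter_upwards [eventually_ge_atTop 0] with t ht x
      rw [norm_mul, Real.norm_eq_abs, Real.norm_eq_abs, abs_of_nonneg (hq.nonneg x),
        abs_of_nonneg (hP.nonneg t ht x y)]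
      exact mul_le_of_le_one_right (hq.nonneg x) (hP.le_one ht x y))
  rw [(hq.total.mul_right (p y)).tsum_eq, one_mul] at key
  refine tendsto_nhds_unique (tendsto_const_nhds.congr' ?_) key
  filter_upwards [eventually_ge_atTop 0] with t ht
  exact (hq.invariant t ht y).tsum_eq.symm

/-- A transition function with bounded exit rates and a state `o` that is accessible from every
state converges to every strictly positive probability distribution that its generator
annihilates, and that distribution is its only stationary one. -/
theorem isStationaryDistribution_and_unique_and_tendsto [Countable S] {p : S → ℝ} {C : ℝ} {o : S}
    (hp : ∀ x, 0 < p x) (hp1 : HasSum p 1) (hC : ∀ x, -Q x x ≤ C)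
    (hinv : ∀ y, HasSum (fun x => p x * Q x y) 0)
    (ho : ∀ x, Relation.ReflTransGen (fun u v => u ≠ v ∧ 0 < Q u v) x o) :
    IsStationaryDistribution P p ∧ (∀ q, IsStationaryDistribution P q → q = p) ∧
      ∀ x y, Tendsto (fun t => P t x y) atTop (𝓝 (p y)) := by
  let q : Ell1 S := ofSummable p hp1.summable
  have hlim : ∀ x y, Tendsto (fun t => P t x y) atTop (𝓝 (p y)) :=
    hP.tendsto_of_invariant (p := q)
      (fun t ht => hP.semigroup_eq_self (p := q) (fun x => (hp x).le) hC hinv ht)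
      (fun x => hP.pos_of_reflTransGen (ho x) 1 one_pos) hp hp1
  exact ⟨hP.isStationaryDistribution (p := q) (fun x => (hp x).le) hC hinv hp1,
    fun _ => hP.eq_of_isStationaryDistribution hlim, hlim⟩

end IsTransitionFunction

/-! ### Roots of the characteristic polynomial of the recursion for `tandemW`. -/

section Roots

/-- The cubic $q(x)=(\lambda+\mu_1+\mu_2(1-x^2))x$ is concave for $x\ge0$. It equals
$2\sqrt{\lambda\mu_1}$ at $\sqrt\eta$ because $\tau(\eta)=0$, and is at least that at
$\sqrt{\lambda/\mu_2}$ by the arithmetic–geometric mean inequality, hence also at $\sqrt z$. -/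
theorem tandem_discriminant {lam μ₁ μ₂ η z : ℝ} (hlam : 0 < lam) (h₁ : lam < μ₁) (h₂ : μ₁ < μ₂)
    (hη : 0 < η) (hτ : tandemTau lam μ₁ μ₂ η = 0) (hηz : η ≤ z) (hz : z ≤ lam / μ₂) :
    4 * (lam * μ₁) ≤ (lam + μ₁ + μ₂ * (1 - z)) ^ 2 * z := by
  have hμ₁ : 0 < μ₁ := hlam.trans h₁
  have hμ₂ : 0 < μ₂ := hμ₁.trans h₂
  have hz0 : 0 < z := hη.trans_le hηz
  have hρ : 0 < lam / μ₂ := div_pos hlam hμ₂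
  obtain ⟨e, he⟩ : ∃ e, e = √η := ⟨_, rfl⟩
  obtain ⟨s, hs⟩ : ∃ s, s = √z := ⟨_, rfl⟩
  obtain ⟨r, hr⟩ : ∃ r, r = √(lam / μ₂) := ⟨_, rfl⟩
  obtain ⟨m, hm⟩ : ∃ m, m = √(lam * μ₁) := ⟨_, rfl⟩
  have he0 : 0 < e := he ▸ Real.sqrt_pos.2 hη
  have hs0 : 0 < s := hs ▸ Real.sqrt_pos.2 hz0
  have hr0 : 0 < r := hr ▸ Real.sqrt_pos.2 hρ
  have hm0 : 0 ≤ m := hm ▸ Real.sqrt_nonneg _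
  have he2 : e ^ 2 = η := he ▸ Real.sq_sqrt hη.le
  have hs2 : s ^ 2 = z := hs ▸ Real.sq_sqrt hz0.le
  have hr2 : μ₂ * r ^ 2 = lam := by
    rw [hr, Real.sq_sqrt hρ.le]; field_simp
  have hm2 : m ^ 2 = lam * μ₁ := hm ▸ Real.sq_sqrt (by positivity)
  have hes : e ≤ s := by rw [he, hs]; exact Real.sqrt_le_sqrt hηz
  have hsr : s ≤ r := by rw [hs, hr]; exact Real.sqrt_le_sqrt hz
  have hqe : (lam + μ₁ + μ₂ * (1 - e ^ 2)) * e = 2 * m := by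
    rw [tandemTau, Real.sqrt_div (by positivity), ← he, ← hm, ← he2] at hτ
    field_simp at hτ
    linarith
  have hqr : 2 * m ≤ (lam + μ₁ + μ₂ * (1 - r ^ 2)) * r := by
    have e1 : (lam + μ₁ + μ₂ * (1 - r ^ 2)) * r = (μ₁ + μ₂) * r := by
      rw [mul_sub, hr2]; ring
    rw [e1]
    refine (sq_le_sq₀ (by positivity) (by positivity)).1 ?_
    rw [mul_pow, mul_pow, hm2, ← hr2]
    nlinarith [mul_nonneg (sq_nonneg (μ₁ - μ₂)) (sq_nonneg r)]
  have hqs : 2 * m ≤ (lam + μ₁ + μ₂ * (1 - s ^ 2)) * s := by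
    rcases (hes.trans hsr).eq_or_lt with h | h
    · obtain rfl : e = s := le_antisymm hes (h ▸ hsr)
      exact hqe.ge
    · have hpos : 0 ≤ μ₂ * ((s - e) * (r - s) * (r - e) * (s + e + r)) :=
        mul_nonneg hμ₂.le (mul_nonneg (mul_nonneg (mul_nonneg (sub_nonneg.2 hes)
          (sub_nonneg.2 hsr)) (sub_nonneg.2 h.le)) (by positivity))
      have h3 := mul_le_mul_of_nonneg_right hqr (sub_nonneg.2 hes)
      have h4 : (2 * m) * (r - e) ≤ ((lam + μ₁ + μ₂ * (1 - s ^ 2)) * s) * (r - e) := by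
        have h5 : (lam + μ₁ + μ₂ * (1 - e ^ 2)) * e * (r - s) = 2 * m * (r - s) := by rw [hqe]
        linarith
      exact le_of_mul_le_mul_right h4 (sub_pos.2 h)
  have h6 := pow_le_pow_left₀ (by positivity) hqs 2
  rw [mul_pow, mul_pow, hm2, hs2] at h6
  linarith

/-- The polynomial is nonnegative at $z$ and positive at 1. The root sum exceeds $2z$ (here
$\mu_1<\mu_2$ enters) and the root product is below 1, so both roots lie in $[z,1)$. -/
theorem tandem_exists_roots {lam μ₁ μ₂ z : ℝ} (hlam : 0 < lam) (h₁ : lam < μ₁) (h₂ : μ₁ < μ₂)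
    (hz0 : 0 < z) (hz : μ₂ * z ≤ lam)
    (hD : 4 * (lam * μ₁) ≤ (lam + μ₁ + μ₂ * (1 - z)) ^ 2 * z) :
    ∃ r s : ℝ, μ₁ * (r + s) = (lam + μ₁ + μ₂ * (1 - z)) * z ∧ μ₁ * (r * s) = lam * z ∧
      z ≤ s ∧ s ≤ r ∧ r < 1 ∧ (μ₂ * z = lam → s = z) := by
  have hμ₁ : 0 < μ₁ := hlam.trans h₁
  have hμ₂ : 0 < μ₂ := hμ₁.trans h₂
  have hz1 : z < 1 := by nlinarith
  obtain ⟨b, hb⟩ : ∃ b, b = (lam + μ₁ + μ₂ * (1 - z)) * z / μ₁ := ⟨_, rfl⟩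
  have hb' : μ₁ * b = (lam + μ₁ + μ₂ * (1 - z)) * z := by rw [hb]; field_simp
  have hdisc : 0 ≤ b ^ 2 - 4 * (lam * z / μ₁) := by
    have : b ^ 2 - 4 * (lam * z / μ₁) =
        z / μ₁ ^ 2 * ((lam + μ₁ + μ₂ * (1 - z)) ^ 2 * z - 4 * (lam * μ₁)) := by
      rw [hb]; field_simp
    rw [this]
    exact mul_nonneg (by positivity) (sub_nonneg.2 hD)
  obtain ⟨d, hd⟩ : ∃ d, d = √(b ^ 2 - 4 * (lam * z / μ₁)) := ⟨_, rfl⟩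
  have hd0 : 0 ≤ d := hd ▸ Real.sqrt_nonneg _
  have hd2 : d ^ 2 = b ^ 2 - 4 * (lam * z / μ₁) := hd ▸ Real.sq_sqrt hdisc
  obtain ⟨r, hr⟩ : ∃ r, r = (b + d) / 2 := ⟨_, rfl⟩
  obtain ⟨s, hs⟩ : ∃ s, s = (b - d) / 2 := ⟨_, rfl⟩
  have hsum : μ₁ * (r + s) = (lam + μ₁ + μ₂ * (1 - z)) * z := by
    rw [← hb', hr, hs]; ring
  have hprod : μ₁ * (r * s) = lam * z := by
    have : r * s = lam * z / μ₁ := by rw [hr, hs]; linarith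
    rw [this]; field_simp
  have hsr : s ≤ r := by rw [hr, hs]; linarith
  have hfz : μ₁ * ((r - z) * (s - z)) = z * (1 - z) * (lam - μ₂ * z) := by
    linear_combination hprod - z * hsum
  have hf1 : μ₁ * ((1 - r) * (1 - s)) = (1 - z) * (μ₁ - μ₂ * z) := by
    linear_combination hprod - hsum
  have h2z : 0 < r + s - 2 * z := by
    have : 0 < μ₁ * (r + s - 2 * z) := by
      have : μ₁ * (r + s - 2 * z) = z * (lam - μ₂ * z + (μ₂ - μ₁)) := by
        linear_combination hsum
      rw [this]
      exact mul_pos hz0 (by linarith)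
    exact pos_of_mul_pos_right this hμ₁.le
  have hrz : 0 < r - z := by linarith
  have hzs : z ≤ s := by
    have h0 : 0 ≤ μ₁ * ((r - z) * (s - z)) := by
      rw [hfz]
      exact mul_nonneg (mul_nonneg hz0.le (by linarith)) (by linarith)
    have h3 := nonneg_of_mul_nonneg_right h0 hμ₁
    linarith [nonneg_of_mul_nonneg_right h3 hrz]
  refine ⟨r, s, hsum, hprod, hzs, hsr, ?_, fun h => ?_⟩
  · have h0 : 0 < μ₁ * ((1 - r) * (1 - s)) := by
      rw [hf1]
      exact mul_pos (by linarith) (by linarith)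
    have h3 := pos_of_mul_pos_right h0 hμ₁.le
    by_contra hcon
    have hr1 := not_lt.1 hcon
    have hs1 : 1 < s := by
      by_contra hs1
      nlinarith [mul_nonneg (sub_nonneg.2 hr1) (sub_nonneg.2 (not_lt.1 hs1))]
    have : 1 ≤ r * s := by nlinarith
    nlinarith
  · rw [h, sub_self, mul_zero] at hfz
    have := (mul_eq_zero.1 ((mul_eq_zero.1 hfz).resolve_left hμ₁.ne')).resolve_left hrz.ne'
    linarith

end Roots

/-! ### Positivity and summability of the phase vector. -/

section Vector

variable {lam μ₁ μ₂ z : ℝ}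

theorem tandemW_one (hμ₁ : μ₁ ≠ 0) :
    μ₁ * tandemW lam μ₁ μ₂ z 1 = (lam + μ₂ * (1 - z)) * z := by
  rw [tandemW]; field_simp

theorem tandemW_add_two (hμ₁ : μ₁ ≠ 0) (k : ℕ) :
    μ₁ * tandemW lam μ₁ μ₂ z (k + 2) =
      (lam + μ₁ + μ₂ * (1 - z)) * z * tandemW lam μ₁ μ₂ z (k + 1)
        - lam * z * tandemW lam μ₁ μ₂ z k := by
  rw [tandemW]; field_simp

variable {r s : ℝ} (hμ₁ : 0 < μ₁) (hsum : μ₁ * (r + s) = (lam + μ₁ + μ₂ * (1 - z)) * z)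
  (hprod : μ₁ * (r * s) = lam * z)

include hμ₁ hsum hprod

/-- The differences $w_{k+1}-rw_k$ are geometric with ratio $s$, starting from $w_1-r=s-z$. This
form also covers the double root $r=s$. -/
theorem tandemW_succ (k : ℕ) :
    tandemW lam μ₁ μ₂ z (k + 1) = r * tandemW lam μ₁ μ₂ z k + s ^ k * (s - z) := by
  refine mul_left_cancel₀ hμ₁.ne' ?_
  induction k with
  | zero =>
    rw [zero_add, tandemW_one hμ₁.ne', tandemW, pow_zero]
    linear_combination -hsum
  | succ k ih =>
    have ih' := mul_left_cancel₀ hμ₁.ne' ih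
    rw [tandemW_add_two hμ₁.ne', ← hsum, ← hprod, pow_succ]
    rw [ih']
    ring

variable (hz0 : 0 < z) (hzs : z ≤ s) (hsr : s ≤ r)

include hz0 hzs

theorem mul_tandemW_le (k : ℕ) :
    r * tandemW lam μ₁ μ₂ z k ≤ tandemW lam μ₁ μ₂ z (k + 1) := by
  rw [tandemW_succ hμ₁ hsum hprod]
  exact le_add_of_nonneg_right
    (mul_nonneg (pow_pos (hz0.trans_le hzs) k).le (sub_nonneg.2 hzs))

include hsr

theorem tandemW_pos (k : ℕ) : 0 < tandemW lam μ₁ μ₂ z k := by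
  have hs0 : 0 < s := hz0.trans_le hzs
  induction k with
  | zero => rw [tandemW]; exact one_pos
  | succ k ih =>
    rw [tandemW_succ hμ₁ hsum hprod]
    exact add_pos_of_pos_of_nonneg (mul_pos (hs0.trans_le hsr) ih)
      (mul_nonneg (pow_pos hs0 k).le (sub_nonneg.2 hzs))

theorem pow_le_tandemW (k : ℕ) : s ^ k ≤ tandemW lam μ₁ μ₂ z k := by
  have hs0 : 0 < s := hz0.trans_le hzs
  induction k with
  | zero => rw [tandemW, pow_zero]
  | succ k ih =>
    refine le_trans ?_ (mul_tandemW_le hμ₁ hsum hprod hz0 hzs k)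
    rw [pow_succ']
    exact mul_le_mul hsr ih (pow_pos hs0 k).le (hs0.trans_le hsr).le

/-- The factor on the right is $\mu_1w_1=\mu_1(r+s-z)$, so the claim reduces to $s^k\le w_k$. It
yields the strict positivity of the removal rates. -/
theorem mul_tandemW_succ_le (k : ℕ) :
    μ₁ * tandemW lam μ₁ μ₂ z (k + 1) ≤ (lam + μ₂ * (1 - z)) * z * tandemW lam μ₁ μ₂ z k := by
  have h1 : (lam + μ₂ * (1 - z)) * z = μ₁ * (r + (s - z)) := by linear_combination -hsum
  have h2 := mul_le_mul_of_nonneg_right (pow_le_tandemW hμ₁ hsum hprod hz0 hzs hsr k)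
    (sub_nonneg.2 hzs)
  rw [h1, tandemW_succ hμ₁ hsum hprod, mul_assoc]
  refine mul_le_mul_of_nonneg_left ?_ hμ₁.le
  linarith

theorem summable_tandemW (hr1 : r < 1) : Summable (tandemW lam μ₁ μ₂ z) := by
  have hs0 : 0 < s := hz0.trans_le hzs
  have hs1 : s < 1 := hsr.trans_lt hr1
  have hr : 0 < 1 - r := sub_pos.2 hr1
  -- The constant is the fixed point of $S\mapsto rS+1+(s-z)/(1-s)$, which dominates the recursion
  -- of the partial sums.
  refine summable_of_sum_range_le (c := (1 + (s - z) * (1 - s)⁻¹) / (1 - r))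
    (fun k => (tandemW_pos hμ₁ hsum hprod hz0 hzs hsr k).le) fun n => ?_
  have hB : 0 ≤ 1 + (s - z) * (1 - s)⁻¹ := by
    have : 0 ≤ (1 - s)⁻¹ := inv_nonneg.2 (sub_nonneg.2 hs1.le)
    have := mul_nonneg (sub_nonneg.2 hzs) this
    linarith
  rw [le_div_iff₀ hr]
  induction n with
  | zero => simpa using hB
  | succ n ih =>
    have hgeo : ∑ k ∈ Finset.range n, s ^ k ≤ (1 - s)⁻¹ := by
      rw [← tsum_geometric_of_lt_one hs0.le hs1]
      exact (summable_geometric_of_lt_one hs0.le hs1).sum_le_tsum _ fun k _ => (pow_pos hs0 k).le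
    have h1 := mul_le_mul_of_nonneg_left hgeo (sub_nonneg.2 hzs)
    rw [Finset.sum_range_succ']
    simp only [tandemW_succ hμ₁ hsum hprod, Finset.sum_add_distrib, ← Finset.mul_sum,
      ← Finset.sum_mul]
    rw [tandemW]
    have h2 := mul_le_mul_of_nonneg_left ih (hz0.trans_le (hzs.trans hsr)).le
    have h3 := mul_le_mul_of_nonneg_right h1 hr.le
    linarith

end Vector

/-! ### Closed form of the removal rates. -/

section Removal

variable {lam μ₁ μ₂ z : ℝ} (hw : ∀ k, 0 < tandemW lam μ₁ μ₂ z k)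

include hw

theorem removalRate_one_mul :
    removalRate lam μ₁ μ₂ z 1 * tandemW lam μ₁ μ₂ z 1 = lam - μ₂ * z := by
  rw [removalRate, div_mul_cancel₀ _ (hw 1).ne', tandemW, mul_one]

theorem removalRate_add_two_mul (i : ℕ) :
    removalRate lam μ₁ μ₂ z (i + 2) * tandemW lam μ₁ μ₂ z (i + 2) =
      (removalRate lam μ₁ μ₂ z (i + 1) + lam + μ₁ - μ₂ * z) * tandemW lam μ₁ μ₂ z (i + 1)
        - lam * tandemW lam μ₁ μ₂ z i := by
  rw [removalRate, div_mul_cancel₀ _ (hw (i + 2)).ne']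

/-- Flow balance across the cut between phases $i$ and $i+1$, summed over all levels. Algebraically,
the recursion for the rates telescopes. -/
theorem removalRate_succ_mul (hμ₁ : μ₁ ≠ 0) (i : ℕ) :
    (1 - z) * (removalRate lam μ₁ μ₂ z (i + 1) * tandemW lam μ₁ μ₂ z (i + 1)) =
      lam * tandemW lam μ₁ μ₂ z i - μ₁ * tandemW lam μ₁ μ₂ z (i + 1) := by
  induction i with
  | zero =>
    rw [zero_add, removalRate_one_mul hw, tandemW_one hμ₁, tandemW]
    ring
  | succ i ih =>
    rw [removalRate_add_two_mul hw, tandemW_add_two hμ₁]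
    linear_combination ih

end Removal

theorem hasSum_ite_and_eq {S : Type*} [DecidableEq S] (A : Prop) [Decidable A] (v : S) (a : ℝ) :
    HasSum (fun y => if A ∧ y = v then a else 0) (if A then a else 0) := by
  by_cases hA : A
  · simpa [hA] using hasSum_ite_eq v a
  · simp [hA]

theorem hasSum_mul_ite_of_iff {S : Type*} [DecidableEq S] (p a : S → ℝ) (c : S → Prop)
    [DecidablePred c] (A : Prop) [Decidable A] (v : S) (h : ∀ x, c x ↔ A ∧ x = v) :
    HasSum (fun x => p x * if c x then a x else 0) (if A then p v * a v else 0) := by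
  refine (hasSum_ite_and_eq A v (p v * a v)).congr_fun fun x => ?_
  by_cases hx : A ∧ x = v
  · rw [if_pos hx, if_pos ((h x).2 hx), hx.2]
  · rw [if_neg hx, if_neg (mt (h x).1 hx), mul_zero]

/-! ### The tandem generator: row sums, bounds, accessibility of the empty state. -/

section Generator

variable {lam μ₁ μ₂ : ℝ} {ν : ℕ → ℝ}

theorem tandemJumpRate_self (x : ℕ × ℕ) : tandemJumpRate lam μ₁ μ₂ ν x x = 0 := by
  obtain ⟨k, i⟩ := x
  have h1 : ¬ ((k, i) = (k, i + 1)) := by simp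
  have h2 : ¬ (1 ≤ i ∧ (k, i) = (k + 1, i - 1)) := by simp
  have h3 : ¬ (1 ≤ k ∧ (k, i) = (k - 1, i)) := by simp only [Prod.mk.injEq]; omega
  have h4 : ¬ (k = 0 ∧ 1 ≤ i ∧ (k, i) = (0, i - 1)) := by simp only [Prod.mk.injEq]; omega
  simp only [tandemJumpRate, if_neg h1, if_neg h2, if_neg h3, if_neg h4, add_zero]

theorem tandemGenerator_eq (x y : ℕ × ℕ) :
    tandemGenerator lam μ₁ μ₂ ν x y = tandemJumpRate lam μ₁ μ₂ ν x y
      - if x = y then tandemExitRate lam μ₁ μ₂ ν x else 0 := by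
  rw [tandemGenerator]
  split_ifs with h
  · rw [← h, tandemJumpRate_self, zero_sub]
  · rw [sub_zero]

theorem hasSum_tandemGenerator (x : ℕ × ℕ) : HasSum (tandemGenerator lam μ₁ μ₂ ν x) 0 := by
  have h1 := hasSum_ite_eq (x.1, x.2 + 1) lam
  have h2 := hasSum_ite_and_eq (1 ≤ x.2) (x.1 + 1, x.2 - 1) μ₁
  have h3 := hasSum_ite_and_eq (1 ≤ x.1) (x.1 - 1, x.2) μ₂
  have h4 := hasSum_ite_and_eq (x.1 = 0 ∧ 1 ≤ x.2) (0, x.2 - 1) (ν x.2)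
  have h5 := hasSum_ite_eq x (tandemExitRate lam μ₁ μ₂ ν x)
  have h := (((h1.add h2).add h3).add h4).sub h5
  rw [← tandemExitRate, sub_self] at h
  refine h.congr_fun fun y => ?_
  simp only [tandemGenerator_eq, tandemJumpRate, and_assoc, eq_comm]

theorem neg_tandemGenerator_self_le (hμ₁ : 0 < μ₁) (hμ₂ : 0 < μ₂) {M : ℝ} (hM0 : 0 ≤ M) (hM : ∀ i, 1 ≤ i → ν i ≤ M)
    (x : ℕ × ℕ) : -tandemGenerator lam μ₁ μ₂ ν x x ≤ lam + μ₁ + μ₂ + M := by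
  rw [tandemGenerator, if_pos rfl, neg_neg, tandemExitRate]
  refine add_le_add (add_le_add (add_le_add le_rfl ?_) ?_) ?_
  · split_ifs; exacts [le_rfl, hμ₁.le]
  · split_ifs; exacts [le_rfl, hμ₂.le]
  · split_ifs with h; exacts [hM _ h.2, hM0]

variable (hlam : 0 < lam) (hμ₁ : 0 < μ₁) (hμ₂ : 0 < μ₂) (hν : ∀ i, 1 ≤ i → 0 ≤ ν i)

include hlam hμ₁ hμ₂

include hν in
theorem tandemGenerator_nonneg {x y : ℕ × ℕ} (hxy : x ≠ y) :
    0 ≤ tandemGenerator lam μ₁ μ₂ ν x y := by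
  rw [tandemGenerator, if_neg hxy, tandemJumpRate]
  refine add_nonneg (add_nonneg (add_nonneg ?_ ?_) ?_) ?_
  · split_ifs; exacts [hlam.le, le_rfl]
  · split_ifs; exacts [hμ₁.le, le_rfl]
  · split_ifs; exacts [hμ₂.le, le_rfl]
  · split_ifs with h; exacts [hν _ h.2.1, le_rfl]

include hν in
theorem tandemGenerator_pos_service_one (k i : ℕ) :
    0 < tandemGenerator lam μ₁ μ₂ ν (k, i + 1) (k + 1, i) := by
  rw [tandemGenerator, if_neg (by simp), tandemJumpRate]
  refine add_pos_of_pos_of_nonneg (add_pos_of_pos_of_nonneg (add_pos_of_nonneg_of_pos ?_ ?_) ?_) ?_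
  · split_ifs; exacts [hlam.le, le_rfl]
  · rw [if_pos (by simp)]; exact hμ₁
  · split_ifs; exacts [hμ₂.le, le_rfl]
  · split_ifs with h; exacts [hν _ h.2.1, le_rfl]

theorem tandemGenerator_pos_service_two (k i : ℕ) :
    0 < tandemGenerator lam μ₁ μ₂ ν (k + 1, i) (k, i) := by
  rw [tandemGenerator, if_neg (by simp), tandemJumpRate]
  refine add_pos_of_pos_of_nonneg (add_pos_of_nonneg_of_pos (add_nonneg ?_ ?_) ?_) ?_
  · split_ifs; exacts [hlam.le, le_rfl]
  · split_ifs; exacts [hμ₁.le, le_rfl]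
  · rw [if_pos (by simp)]; exact hμ₂
  · rw [if_neg (by simp)]

include hν in
-- The second queue is emptied, then customers of the first queue pass through one at a time.
-- Removals are avoided, since their rates may vanish.
theorem tandem_reflTransGen_zero (x : ℕ × ℕ) :
    Relation.ReflTransGen (fun u v => u ≠ v ∧ 0 < tandemGenerator lam μ₁ μ₂ ν u v) x (0, 0) := by
  have hlevel : ∀ k i, Relation.ReflTransGen
      (fun u v => u ≠ v ∧ 0 < tandemGenerator lam μ₁ μ₂ ν u v) (k, i) (0, i) := by
    intro k i
    induction k with
    | zero => exact .refl
    | succ k ih =>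
      exact .head ⟨by simp, tandemGenerator_pos_service_two hlam hμ₁ hμ₂ k i⟩ ih
  obtain ⟨k, i⟩ := x
  refine (hlevel k i).trans ?_
  induction i with
  | zero => exact .refl
  | succ i ih =>
    exact .head ⟨by simp, tandemGenerator_pos_service_one hlam hμ₁ hμ₂ hν 0 i⟩
      ((hlevel 1 i).trans ih)

end Generator

/-! ### Balance equations and the product-form solution. -/

theorem hasSum_mul_tandemJumpRate (lam μ₁ μ₂ : ℝ) (ν : ℕ → ℝ) (p : ℕ × ℕ → ℝ) (y : ℕ × ℕ) :
    HasSum (fun x => p x * tandemJumpRate lam μ₁ μ₂ ν x y)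
      ((if 1 ≤ y.2 then p (y.1, y.2 - 1) * lam else 0)
        + (if 1 ≤ y.1 then p (y.1 - 1, y.2 + 1) * μ₁ else 0)
        + p (y.1 + 1, y.2) * μ₂
        + (if y.1 = 0 then p (0, y.2 + 1) * ν (y.2 + 1) else 0)) := by
  obtain ⟨K, i⟩ := y
  have h1 := hasSum_mul_ite_of_iff p (fun _ => lam) (fun x => (K, i) = (x.1, x.2 + 1))
    (1 ≤ i) (K, i - 1) (by rintro ⟨a, b⟩; simp only [Prod.mk.injEq]; omega)
  have h2 := hasSum_mul_ite_of_iff p (fun _ => μ₁)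
    (fun x => 1 ≤ x.2 ∧ (K, i) = (x.1 + 1, x.2 - 1))
    (1 ≤ K) (K - 1, i + 1) (by rintro ⟨a, b⟩; simp only [Prod.mk.injEq]; omega)
  have h3 := hasSum_mul_ite_of_iff p (fun _ => μ₂) (fun x => 1 ≤ x.1 ∧ (K, i) = (x.1 - 1, x.2))
    True (K + 1, i) (by rintro ⟨a, b⟩; simp only [Prod.mk.injEq, true_and]; omega)
  have h4 := hasSum_mul_ite_of_iff p (fun x => ν x.2)
    (fun x => x.1 = 0 ∧ 1 ≤ x.2 ∧ (K, i) = (0, x.2 - 1))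
    (K = 0) (0, i + 1) (by rintro ⟨a, b⟩; simp only [Prod.mk.injEq]; omega)
  rw [if_pos trivial] at h3
  refine (((h1.add h2).add h3).add h4).congr_fun fun x => ?_
  simp only [tandemJumpRate, mul_add]

theorem hasSum_mul_tandemGenerator {lam μ₁ μ₂ : ℝ} {ν : ℕ → ℝ} {p : ℕ × ℕ → ℝ} {y : ℕ × ℕ}
    (h : (if 1 ≤ y.2 then p (y.1, y.2 - 1) * lam else 0)
        + (if 1 ≤ y.1 then p (y.1 - 1, y.2 + 1) * μ₁ else 0)
        + p (y.1 + 1, y.2) * μ₂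
        + (if y.1 = 0 then p (0, y.2 + 1) * ν (y.2 + 1) else 0)
        = p y * tandemExitRate lam μ₁ μ₂ ν y) :
    HasSum (fun x => p x * tandemGenerator lam μ₁ μ₂ ν x y) 0 := by
  have h1 := hasSum_mul_tandemJumpRate lam μ₁ μ₂ ν p y
  have h2 := hasSum_mul_ite_of_iff p (tandemExitRate lam μ₁ μ₂ ν) (fun x => x = y) True y
    (by simp)
  rw [if_pos trivial] at h2
  have h3 := h1.sub h2
  rw [h, sub_self] at h3
  refine h3.congr_fun fun x => ?_
  rw [tandemGenerator_eq, mul_sub]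

theorem hasSum_geometric_mul_tandemGenerator {lam μ₁ μ₂ z : ℝ} (hμ₁ : μ₁ ≠ 0)
    (hw : ∀ k, 0 < tandemW lam μ₁ μ₂ z k) (c : ℝ) (y : ℕ × ℕ) :
    HasSum (fun x : ℕ × ℕ => c * z ^ x.1 * tandemW lam μ₁ μ₂ z x.2
      * tandemGenerator lam μ₁ μ₂ (removalRate lam μ₁ μ₂ z) x y) 0 := by
  refine hasSum_mul_tandemGenerator (p := fun x => c * z ^ x.1 * tandemW lam μ₁ μ₂ z x.2) ?_
  have hw0 : tandemW lam μ₁ μ₂ z 0 = 1 := by rw [tandemW]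
  have h1 := tandemW_one (lam := lam) (μ₂ := μ₂) (z := z) hμ₁
  have h2 := tandemW_add_two (lam := lam) (μ₂ := μ₂) (z := z) hμ₁
  have h3 := removalRate_one_mul hw
  have h4 := removalRate_add_two_mul hw
  obtain ⟨K, i⟩ := y
  -- The four cases use, in order, the two equations defining `removalRate` and the two defining
  -- `tandemW`.
  rcases K with _ | K <;> rcases i with _ | i
  · simp [tandemExitRate, hw0]
    linear_combination c * h3
  · simp [tandemExitRate]
    linear_combination c * h4 i
  · simp [tandemExitRate, hw0, pow_succ]
    linear_combination c * z ^ K * h1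
  · simp [tandemExitRate, pow_succ]
    linear_combination c * z ^ K * h2 i

theorem hasSum_geometric_mul {z : ℝ} {w : ℕ → ℝ} (hz0 : 0 < z) (hz1 : z < 1)
    (hw : ∀ k, 0 < w k) (hws : Summable w) :
    HasSum (fun x : ℕ × ℕ => (1 - z) * (∑' i, w i)⁻¹ * z ^ x.1 * w x.2) 1 := by
  have hW : 0 < ∑' i, w i := hws.tsum_pos (fun i => (hw i).le) 0 (hw 0)
  have hz1' : 0 < 1 - z := sub_pos.2 hz1
  have h1 := (hasSum_geometric_of_lt_one hz0.le hz1).mul_left ((1 - z) * (∑' i, w i)⁻¹)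
  have h0 : Summable fun x : ℕ × ℕ => (1 - z) * (∑' i, w i)⁻¹ * z ^ x.1 * w x.2 :=
    Summable.mul_of_nonneg (f := fun n => (1 - z) * (∑' i, w i)⁻¹ * z ^ n) h1.summable hws
      (fun n => mul_nonneg (mul_pos hz1' (inv_pos.2 hW)).le (pow_pos hz0 n).le)
      fun i => (hw i).le
  have h2 := h1.mul hws.hasSum h0
  have e : (1 - z) * (∑' i, w i)⁻¹ * (1 - z)⁻¹ * ∑' i, w i = 1 := by field_simp
  rwa [e] at h2

theorem proposition6p2 (lam μ₁ μ₂ η z : ℝ)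
    (hlam : 0 < lam) (hstable : lam < min μ₁ μ₂) (hμ : μ₁ < μ₂)
    (hη : η ∈ Set.Ioo (0 : ℝ) 1) (hτ : tandemTau lam μ₁ μ₂ η = 0)
    (hz : z ∈ Set.Icc η (lam / μ₂)) :
    (∀ k, 0 < tandemW lam μ₁ μ₂ z k) ∧
    Summable (tandemW lam μ₁ μ₂ z) ∧
    (z < lam / μ₂ → ∀ i, 1 ≤ i → 0 < removalRate lam μ₁ μ₂ z i) ∧
    (z = lam / μ₂ → ∀ i, 1 ≤ i → removalRate lam μ₁ μ₂ z i = 0) ∧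
    (∃ P, IsTransitionFunction
      (tandemGenerator lam μ₁ μ₂ (removalRate lam μ₁ μ₂ z)) P) ∧
    ∃ p : ℕ × ℕ → ℝ,
      (∀ P, IsTransitionFunction
          (tandemGenerator lam μ₁ μ₂ (removalRate lam μ₁ μ₂ z)) P →
        IsStationaryDistribution P p ∧
        (∀ p', IsStationaryDistribution P p' → p' = p) ∧
        ∀ x y, Tendsto (fun t => P t x y) atTop (𝓝 (p y))) ∧
      (∃ c : ℝ, 0 < c ∧ ∀ K i, p (K, i) = c * z ^ K * tandemW lam μ₁ μ₂ z i) ∧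
      (∀ i, HasGeometricDecayRate (fun K => p (K, i)) z) ∧
      HasGeometricDecayRate (fun K => ∑' i, p (K, i)) z := by
  have h₁ : lam < μ₁ := (lt_min_iff.1 hstable).1
  have hμ₁ : 0 < μ₁ := hlam.trans h₁
  have hμ₂ : 0 < μ₂ := hμ₁.trans hμ
  have hz0 : 0 < z := hη.1.trans_le hz.1
  have hzle : μ₂ * z ≤ lam := by rw [mul_comm]; exact (le_div_iff₀ hμ₂).1 hz.2
  have hz1 : z < 1 := hz.2.trans_lt ((div_lt_one hμ₂).2 (h₁.trans hμ))
  have hz1' : 0 < 1 - z := sub_pos.2 hz1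
  obtain ⟨r, s, hsum, hprod, hzs, hsr, hr1, hcrit⟩ := tandem_exists_roots hlam h₁ hμ hz0 hzle
    (tandem_discriminant hlam h₁ hμ hη.1 hτ hz.1 hz.2)
  have hr0 : 0 < r := hz0.trans_le (hzs.trans hsr)
  have hw := tandemW_pos hμ₁ hsum hprod hz0 hzs hsr
  have hws := summable_tandemW hμ₁ hsum hprod hz0 hzs hsr hr1
  have hν := removalRate_succ_mul hw hμ₁.ne'
  have hνpos : z < lam / μ₂ → ∀ i, 1 ≤ i → 0 < removalRate lam μ₁ μ₂ z i := by
    intro hlt i hi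
    obtain ⟨i, rfl⟩ := Nat.exists_eq_add_of_le' hi
    have hlt' : μ₂ * z < lam := by rw [mul_comm]; exact (lt_div_iff₀ hμ₂).1 hlt
    have h2 := mul_tandemW_succ_le hμ₁ hsum hprod hz0 hzs hsr i
    have h3 : 0 < (1 - z) * (removalRate lam μ₁ μ₂ z (i + 1) * tandemW lam μ₁ μ₂ z (i + 1)) := by
      rw [hν]
      have := mul_pos (mul_pos hz1' (sub_pos.2 hlt')) (hw i)
      linarith
    exact pos_of_mul_pos_left (pos_of_mul_pos_right h3 hz1'.le) (hw _).le
  have hνzero : z = lam / μ₂ → ∀ i, 1 ≤ i → removalRate lam μ₁ μ₂ z i = 0 := by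
    intro heq i hi
    obtain ⟨i, rfl⟩ := Nat.exists_eq_add_of_le' hi
    have heq' : μ₂ * z = lam := by rw [heq]; field_simp
    have hsz := hcrit heq'
    have h2 : (1 - z) * (removalRate lam μ₁ μ₂ z (i + 1) * tandemW lam μ₁ μ₂ z (i + 1)) = 0 := by
      -- At $z=\lambda/\mu_2$ the roots are $z$ and $\lambda/\mu_1$, so $w$ is geometric with ratio
      -- $\lambda/\mu_1$.
      have hr : μ₁ * r = lam := by
        rw [hsz] at hsum
        linear_combination hsum + (1 - z) * heq'
      rw [hν, tandemW_succ hμ₁ hsum hprod, hsz, ← hr]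
      ring
    exact (mul_eq_zero.1 ((mul_eq_zero.1 h2).resolve_left hz1'.ne')).resolve_right (hw _).ne'
  have hνnonneg : ∀ i, 1 ≤ i → 0 ≤ removalRate lam μ₁ μ₂ z i := fun i hi => by
    rcases hz.2.lt_or_eq with h | h
    · exact (hνpos h i hi).le
    · exact (hνzero h i hi).ge
  -- This bound follows from $(1-z)\nu_{i+1}w_{i+1}\le\lambda w_i$ and $rw_i\le w_{i+1}$; it makes
  -- the exit rates bounded.
  have hM0 : 0 ≤ lam / ((1 - z) * r) := by positivity
  have hνle : ∀ i, 1 ≤ i → removalRate lam μ₁ μ₂ z i ≤ lam / ((1 - z) * r) := by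
    intro i hi
    obtain ⟨i, rfl⟩ := Nat.exists_eq_add_of_le' hi
    rw [le_div_iff₀ (mul_pos hz1' hr0)]
    refine le_of_mul_le_mul_right ?_ (hw i)
    have h2 := mul_le_mul_of_nonneg_left (mul_tandemW_le hμ₁ hsum hprod hz0 hzs i)
      (mul_nonneg hz1'.le (hνnonneg (i + 1) hi))
    have h3 := hν i
    have h4 := mul_pos hμ₁ (hw (i + 1))
    linarith
  have hdiag := neg_tandemGenerator_self_le (lam := lam) hμ₁ hμ₂ hM0 hνle
  refine ⟨hw, hws, hνpos, hνzero, exists_isTransitionFunction _ _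
    (fun x y => tandemGenerator_nonneg hlam hμ₁ hμ₂ hνnonneg) hdiag hasSum_tandemGenerator, ?_⟩
  have hW : 0 < ∑' i, tandemW lam μ₁ μ₂ z i := hws.tsum_pos (fun i => (hw i).le) 0 (hw 0)
  obtain ⟨c, hc⟩ : ∃ c, c = (1 - z) * (∑' i, tandemW lam μ₁ μ₂ z i)⁻¹ := ⟨_, rfl⟩
  have hc0 : 0 < c := hc ▸ mul_pos hz1' (inv_pos.2 hW)
  have hp1 : HasSum (fun x : ℕ × ℕ => c * z ^ x.1 * tandemW lam μ₁ μ₂ z x.2) 1 := by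
    rw [hc]
    exact hasSum_geometric_mul hz0 hz1 hw hws
  have hpos : ∀ x : ℕ × ℕ, 0 < c * z ^ x.1 * tandemW lam μ₁ μ₂ z x.2 := fun x =>
    mul_pos (mul_pos hc0 (pow_pos hz0 _)) (hw _)
  refine ⟨fun x => c * z ^ x.1 * tandemW lam μ₁ μ₂ z x.2, fun P hP => ?_,
    ⟨c, hc0, fun K i => rfl⟩, fun i => ⟨c * tandemW lam μ₁ μ₂ z i, mul_pos hc0 (hw i), ?_⟩,
    ⟨c * ∑' i, tandemW lam μ₁ μ₂ z i, mul_pos hc0 hW, ?_⟩⟩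
  · exact hP.isStationaryDistribution_and_unique_and_tendsto hpos hp1 hdiag
      (hasSum_geometric_mul_tandemGenerator hμ₁.ne' hw c)
      (tandem_reflTransGen_zero hlam hμ₁ hμ₂ hνnonneg)
  · refine tendsto_const_nhds.congr fun K => ?_
    have := (pow_pos hz0 K).ne'
    field_simp
  · refine tendsto_const_nhds.congr fun K => ?_
    have := (pow_pos hz0 K).ne'
    simp only [tsum_mul_left]
    field_simp

end
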